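/- Let $q\in\mathbb{C}$ with $|q|<1$. Write $(a;q)_n=\prod_{i=0}^{n-1}(1-aq^i)$, $(a_1,\dots,a_j;q)_n=(a_1;q)_n\cdots(a_j;q)_n$, and let $\phi(q)=\sum_{n=-\infty}^{\infty}q^{n^2}$. Then \begin{align*} \phi(q)^2&=1-4\sum_{n=1}^{\infty}\frac{(-1)^nq^{2n^2-n}}{(q;q^4)_n(1-q^{4n})}+4\sum_{n=1}^{\infty}\frac{(-1)^nq^{2n^2+n}}{(q^3;q^4)_n(1-q^{4n})}\\ &=1+4\sum_{n=1}^{\infty}\frac{(1-q^{8n-3})q^{4n^2-3n}}{(1-q^{4n-3})(1-q^{4n})}-4\sum_{n=1}^{\infty}\frac{(1-q^{8n-1})q^{4n^2-n}}{(1-q^{4n-1})(1-q^{4n})}. \end{align*} Moreover, if $q\neq 0$, then for all $c,d\in\mathbb{C}$ for which no denominator below vanishes (that is, $c,d\neq0$ and $(q^3/c,q^3/d,q/c,q/d;q^4)_n\neq0$ for all $n\ge 1$), \begin{align*} \phi(q)^2={}&1+4\sum_{n=1}^{\infty}\frac{(q^4;q^4)_{n-1}(q^3/cd;q^4)_n(-1)^nq^{2n^2+n}}{(q^3/c,q^3/d,q^4;q^4)_n}\\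 &-4\sum_{n=1}^{\infty}\frac{(q^4;q^4)_{n-1}(q/cd;q^4)_n(-1)^nq^{2n^2-n}}{(q/c,q/d,q^4;q^4)_n}\\ &-4\sum_{n=1}^{\infty}\frac{(1-q^{8n-1})(q^4;q^4)_{n-1}(1/q,c,d;q^4)_n\,q^{4n^2+2n}}{(1-1/q)(q^3/c,q^3/d,q^3,q^4;q^4)_n\,c^nd^n}\\ &+4\sum_{n=1}^{\infty}\frac{(1-q^{8n-3})(q^4;q^4)_{n-1}(1/q^3,c,d;q^4)_n\,q^{4n^2-2n}}{(1-1/q^3)(q/c,q/d,q,q^4;q^4)_n\,c^nd^n}. \end{align*} All the series converge absolutely. -/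

import Mathlib

/-- The finite `q`-shifted factorial `(a;q)_n = (1 - a)(1 - a q) ⋯ (1 - a q^(n-1))`. -/
noncomputable def qPoch (a q : ℂ) (n : ℕ) : ℂ :=
  ∏ i ∈ Finset.range n, (1 - a * q ^ i)

/-- Ramanujan's theta function `φ(q) = ∑_{n ∈ ℤ} q^(n²)`. -/
noncomputable def ramanujanPhi (q : ℂ) : ℂ :=
  ∑' n : ℤ, q ^ (n ^ 2)

/-!
Rogers' sum of a very-well-poised `₆φ₅` series, with some of its parameters sent to infinity,
evaluates `φ(-p)` as `(p;p)_∞ / (-p;p)_∞` and the square of this quotient as an alternating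
Lambert-type series. Pairing consecutive terms of the latter gives Clausen's form of a Lambert
series, and with `L(x) = ∑_{m ≥ 0} x^m / (1 - q^4 q^(4m))` one arrives at
`φ(q)² = 1 + 4 (q L(q) - q³ L(q³))`.

The first two expansions come from two ways of rewriting `L`: as an alternating series with
shifted factorials, and as Clausen's series. For the two-parameter identity, the terminating case
of Rogers' sum is inserted in the `n`-th term of the alternating series, with parameters `c`, `d`
and `q^(-4n)`. Summing the resulting double series over `n` first leaves a `₁φ₁` series that has
a product formula, so that the double series becomes the very-well-poised one (Bailey's method).
-/

open Filter Topology Asymptotics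

/-! ### Shifted factorials -/

lemma norm_mul_pow_lt_one {K : Type*} [NormedDivisionRing K] {a p : K} (ha : ‖a‖ < 1)
    (hp : ‖p‖ < 1) (n : ℕ) : ‖a * p ^ n‖ < 1 := by
  rw [norm_mul, norm_pow]
  exact mul_lt_one_of_nonneg_of_lt_one_left (norm_nonneg a) ha
    (pow_le_one₀ (norm_nonneg p) hp.le)

lemma norm_pow_lt_one {K : Type*} [NormedDivisionRing K] {p : K} (hp : ‖p‖ < 1) {n : ℕ}
    (hn : n ≠ 0) : ‖p ^ n‖ < 1 :=
  norm_pow p n ▸ pow_lt_one₀ (norm_nonneg p) hp hn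

section ShiftedFactorial

variable {a p : ℂ}

@[simp] lemma qPoch_zero (a p : ℂ) : qPoch a p 0 = 1 := by simp [qPoch]

@[simp] lemma qPoch_zero_left (p : ℂ) (n : ℕ) : qPoch 0 p n = 1 := by simp [qPoch]

lemma qPoch_succ (a p : ℂ) (n : ℕ) : qPoch a p (n + 1) = qPoch a p n * (1 - a * p ^ n) :=
  Finset.prod_range_succ _ n

lemma qPoch_add (a p : ℂ) (m n : ℕ) :
    qPoch a p (m + n) = qPoch a p m * qPoch (a * p ^ m) p n := by
  simp only [qPoch, Finset.prod_range_add, pow_add, mul_assoc]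

lemma qPoch_succ' (a p : ℂ) (n : ℕ) : qPoch a p (n + 1) = (1 - a) * qPoch (a * p) p n := by
  simpa [qPoch_succ] using (congrArg (qPoch a p) (add_comm n 1)).trans (qPoch_add a p 1 n)

lemma one_sub_mul_pow_ne_zero_of_qPoch (h : ∀ n, qPoch a p n ≠ 0) (n : ℕ) :
    1 - a * p ^ n ≠ 0 :=
  right_ne_zero_of_mul (qPoch_succ a p n ▸ h (n + 1))

lemma qPoch_mul_pow_ne_zero (h : ∀ n, qPoch a p n ≠ 0) (k n : ℕ) : qPoch (a * p ^ k) p n ≠ 0 :=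
  right_ne_zero_of_mul (qPoch_add a p k n ▸ h (k + n))

lemma qPoch_ne_zero (ha : ‖a‖ < 1) (hp : ‖p‖ < 1) (n : ℕ) : qPoch a p n ≠ 0 := by
  refine Finset.prod_ne_zero_iff.2 fun i _ h => ?_
  have hlt := norm_mul_pow_lt_one ha hp i
  rw [← sub_eq_zero.1 h, norm_one] at hlt
  exact lt_irrefl 1 hlt

lemma one_sub_pow_succ_ne_zero (hp : ‖p‖ < 1) (n : ℕ) : 1 - p ^ (n + 1) ≠ 0 :=
  pow_succ' p n ▸ one_sub_mul_pow_ne_zero_of_qPoch (qPoch_ne_zero hp hp) n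

/-- The infinite product `(a;p)_∞`. It is only used for `‖p‖ < 1`, where it converges. -/
noncomputable def qPochInf (a p : ℂ) : ℂ :=
  ∏' i : ℕ, (1 - a * p ^ i)

lemma summable_norm_mul_pow (a : ℂ) (hp : ‖p‖ < 1) : Summable fun i : ℕ => ‖-(a * p ^ i)‖ := by
  simpa only [norm_neg, norm_mul, norm_pow] using
    (summable_geometric_of_lt_one (norm_nonneg p) hp).mul_left ‖a‖

lemma tendsto_qPoch (a : ℂ) (hp : ‖p‖ < 1) :
    Tendsto (qPoch a p) atTop (𝓝 (qPochInf a p)) := by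
  change Tendsto (fun n => qPoch a p n) _ _
  simpa only [qPoch, qPochInf, ← sub_eq_add_neg] using
    (multipliable_one_add_of_summable (summable_norm_mul_pow a hp)).tendsto_prod_tprod_nat

lemma qPochInf_ne_zero (hp : ‖p‖ < 1) (h : ∀ n, qPoch a p n ≠ 0) : qPochInf a p ≠ 0 := by
  simpa only [qPochInf, sub_eq_add_neg] using
    tprod_one_add_ne_zero_of_summable
      (fun i => sub_eq_add_neg (1 : ℂ) _ ▸ one_sub_mul_pow_ne_zero_of_qPoch h i)
      (summable_norm_mul_pow a hp)

lemma isBigO_top_comp {α β E F : Type*} [Norm E] [Norm F] {f : α → E} {g : α → F}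
    (h : f =O[⊤] g) (k : β → α) :
    (fun b => f (k b)) =O[⊤] fun b => g (k b) :=
  h.comp_tendsto tendsto_top

lemma qPoch_isBigO_one (a : ℂ) (hp : ‖p‖ < 1) : qPoch a p =O[⊤] fun _ => (1 : ℝ) := by
  obtain ⟨M, hM⟩ := isBigO_one_nat_atTop_iff.1 ((tendsto_qPoch a hp).isBigO_one ℝ)
  exact isBigO_top.2 ⟨M, by simpa using hM⟩

lemma inv_qPoch_isBigO_one (hp : ‖p‖ < 1) (h : ∀ n, qPoch a p n ≠ 0) :
    (fun n => (qPoch a p n)⁻¹) =O[⊤] fun _ => (1 : ℝ) := by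
  obtain ⟨M, hM⟩ := isBigO_one_nat_atTop_iff.1
    (((tendsto_qPoch a hp).inv₀ (qPochInf_ne_zero hp h)).isBigO_one ℝ)
  exact isBigO_top.2 ⟨M, by simpa using hM⟩

lemma inv_qPoch_mul_pow_isBigO_one (hp : ‖p‖ < 1) (h : ∀ n, qPoch a p n ≠ 0) :
    (fun z : ℕ × ℕ => (qPoch (a * p ^ z.1) p z.2)⁻¹) =O[⊤] fun _ => (1 : ℝ) := by
  have hnum := isBigO_top_comp (qPoch_isBigO_one a hp) fun z : ℕ × ℕ => z.1
  have hden := isBigO_top_comp (inv_qPoch_isBigO_one hp h) fun z : ℕ × ℕ => z.1 + z.2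
  refine (hnum.mul hden).congr (fun z => ?_) fun _ => one_mul 1
  have := h z.1
  rw [qPoch_add]
  field_simp

lemma one_sub_mul_pow_isBigO_one (a : ℂ) (hp : ‖p‖ < 1) :
    (fun n : ℕ => 1 - a * p ^ n) =O[⊤] fun _ => (1 : ℝ) := by
  refine isBigO_top.2 ⟨1 + ‖a‖, fun n => (norm_sub_le _ _).trans ?_⟩
  rw [norm_one, norm_one, mul_one, norm_mul, norm_pow]
  gcongr
  exact mul_le_of_le_one_right (norm_nonneg a) (pow_le_one₀ (norm_nonneg p) hp.le)

lemma inv_one_sub_mul_pow_isBigO_one (hp : ‖p‖ < 1) (h : ∀ n, qPoch a p n ≠ 0) :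
    (fun n : ℕ => (1 - a * p ^ n)⁻¹) =O[⊤] fun _ => (1 : ℝ) := by
  refine (isBigO_top_comp (inv_qPoch_mul_pow_isBigO_one hp h) fun n => (n, 1)).congr_left ?_
  simp [qPoch_succ]

end ShiftedFactorial

lemma summable_pow_mul_pow_choose_two (K : ℝ) {t : ℝ} (h0 : 0 ≤ t) (h1 : t < 1) :
    Summable fun n : ℕ => K ^ n * t ^ (n.choose 2) := by
  have hlim : Tendsto (fun n : ℕ => |K| * t ^ n) atTop (𝓝 0) := by
    simpa using (tendsto_pow_atTop_nhds_zero_of_lt_one h0 h1).const_mul |K|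
  refine summable_of_ratio_norm_eventually_le (r := 1 / 2) (by norm_num) ?_
  filter_upwards [hlim.eventually (eventually_le_nhds (show (0 : ℝ) < 1 / 2 by norm_num))]
    with n hn
  have ratio : K ^ (n + 1) * t ^ ((n + 1).choose 2)
      = (K * t ^ n) * (K ^ n * t ^ (n.choose 2)) := by
    rw [Nat.choose_succ_succ' n 1, Nat.choose_one_right]
    ring
  rw [ratio, norm_mul]
  refine mul_le_mul_of_nonneg_right ?_ (norm_nonneg _)
  rwa [norm_mul, Real.norm_eq_abs, norm_pow, Real.norm_of_nonneg h0]

lemma tsum_isBigO_one_of_isBigO {α β E : Type*} [NormedAddCommGroup E] {f : α → β → E}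
    {g : β → ℝ} (hg : Summable g) (h : (fun z : α × β => f z.1 z.2) =O[⊤] fun z => g z.2) :
    (fun m => ∑' k, f m k) =O[⊤] fun _ => (1 : ℝ) := by
  obtain ⟨M, hM⟩ := isBigO_top.1 h
  refine isBigO_top.2 ⟨M * ∑' k, ‖g k‖, fun m => ?_⟩
  simpa using tsum_of_norm_bounded (hg.norm.hasSum.mul_left M) fun k => hM (m, k)

/-! ### Lambert series -/

section Lambert

variable {x y p : ℂ}

/-- The Lambert series `∑_{m ≥ 0} x^m / (1 - y p^m)`. With this indexing
`x * lambertSeries x p p` is the classical `∑_{m ≥ 1} x^m / (1 - p^m)`. -/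
noncomputable def lambertSeries (x y p : ℂ) : ℂ :=
  ∑' m : ℕ, x ^ m / (1 - y * p ^ m)

lemma summable_lambertSeries (hp : ‖p‖ < 1) (hx : ‖x‖ < 1) (hy : ∀ n, qPoch y p n ≠ 0) :
    Summable fun m : ℕ => x ^ m / (1 - y * p ^ m) := by
  refine summable_of_isBigO_nat (summable_geometric_of_lt_one (norm_nonneg x) hx) ?_
  simpa [div_eq_mul_inv] using ((isBigO_of_le ⊤ fun m => by simp).mul
    (inv_one_sub_mul_pow_isBigO_one hp hy)).mono (le_top : atTop ≤ (⊤ : Filter ℕ))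

lemma lambertSeries_mul_pow_isBigO_one (hp : ‖p‖ < 1) (hx : ‖x‖ < 1)
    (hy : ∀ n, qPoch y p n ≠ 0) :
    (fun n : ℕ => lambertSeries (x * p ^ n) (y * p ^ n) p) =O[⊤] fun _ => (1 : ℝ) := by
  refine tsum_isBigO_one_of_isBigO (summable_geometric_of_lt_one (norm_nonneg x) hx) ?_
  have hnum : (fun z : ℕ × ℕ => (x * p ^ z.1) ^ z.2) =O[⊤] fun z => ‖x‖ ^ z.2 := by
    refine isBigO_of_le ⊤ fun z => ?_
    rw [norm_pow, norm_pow, norm_norm, norm_mul, norm_pow]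
    gcongr
    exact mul_le_of_le_one_right (norm_nonneg x) (pow_le_one₀ (norm_nonneg p) hp.le)
  have hden := isBigO_top_comp (inv_one_sub_mul_pow_isBigO_one hp hy)
    fun z : ℕ × ℕ => z.1 + z.2
  refine (hnum.mul hden).congr (fun z => ?_) fun z => mul_one _
  rw [div_eq_mul_inv, pow_add, mul_assoc y]

lemma lambertSeries_eq_add (hp : ‖p‖ < 1) (hx : ‖x‖ < 1) (hy : ∀ n, qPoch y p n ≠ 0) :
    lambertSeries x y p = (1 - x * y) / ((1 - x) * (1 - y))
      + x * y * p * lambertSeries (x * p) (y * p) p := by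
  have hy0 : ∀ n : ℕ, 1 - y * p ^ n ≠ 0 := one_sub_mul_pow_ne_zero_of_qPoch hy
  have hx1 : 1 - x ≠ 0 := by simpa [qPoch_succ] using qPoch_ne_zero hx hp 1
  have split : ∀ m : ℕ, x ^ m / (1 - y * p ^ m) - x ^ m
      = y * ((x * p) ^ m / (1 - y * p ^ m)) := fun m => by
    have := hy0 m
    rw [mul_pow]
    field_simp
    ring
  have hgeom := hasSum_geometric_of_norm_lt_one hx
  have hdiff := (summable_lambertSeries hp hx hy).hasSum.sub hgeom
  have hdiff0 := hdiff.summable.tsum_eq_zero_add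
  rw [hdiff.tsum_eq] at hdiff0
  have htail : ∀ m : ℕ, x ^ (m + 1) / (1 - y * p ^ (m + 1)) - x ^ (m + 1)
      = x * y * p * ((x * p) ^ m / (1 - y * p * p ^ m)) := fun m => by
    rw [split, pow_succ' p, mul_assoc y p]
    ring
  simp only [htail, tsum_mul_left, pow_zero, mul_one] at hdiff0
  have h0 := hy0 0
  rw [pow_zero, mul_one] at h0
  rw [lambertSeries, sub_eq_iff_eq_add.1 hdiff0, lambertSeries]
  field_simp
  ring

/-- The `k`-th term of Clausen's expansion of `lambertSeries x y p`: it collects the part of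
`∑ x^m y^n p^(mn)` with `min m n = k`. -/
noncomputable def clausenTerm (x y p : ℂ) (k : ℕ) : ℂ :=
  (x * y) ^ k * p ^ (k ^ 2) * (1 - x * y * p ^ (2 * k)) / ((1 - x * p ^ k) * (1 - y * p ^ k))

lemma sum_clausenTerm_add (hp : ‖p‖ < 1) (hx : ‖x‖ < 1) (hy : ∀ n, qPoch y p n ≠ 0) (N : ℕ) :
    ∑ k ∈ Finset.range N, clausenTerm x y p k
        + (x * y) ^ N * p ^ (N ^ 2) * lambertSeries (x * p ^ N) (y * p ^ N) p
      = lambertSeries x y p := by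
  induction N with
  | zero => simp
  | succ N ih =>
    rw [← ih, Finset.sum_range_succ, add_assoc, lambertSeries_eq_add hp
      (norm_mul_pow_lt_one hx hp N) (qPoch_mul_pow_ne_zero hy N), clausenTerm]
    ring_nf

lemma two_mul_choose_two_add (n : ℕ) : 2 * n.choose 2 + n = n ^ 2 := by
  induction n with
  | zero => rfl
  | succ n ih =>
    rw [Nat.choose_succ_succ' n 1, Nat.choose_one_right]
    linarith

lemma summable_norm_pow_mul_pow_sq (K : ℂ) (hp : ‖p‖ < 1) :
    Summable fun n : ℕ => ‖K ^ n * p ^ (n ^ 2)‖ := by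
  refine (summable_pow_mul_pow_choose_two (‖K‖ * ‖p‖) (sq_nonneg ‖p‖)
    (pow_lt_one₀ (norm_nonneg p) hp two_ne_zero)).congr fun n => ?_
  rw [← two_mul_choose_two_add n, norm_mul, norm_pow, norm_pow, mul_pow]
  ring

lemma summable_clausenTerm (hp : ‖p‖ < 1) (hx : ∀ n, qPoch x p n ≠ 0)
    (hy : ∀ n, qPoch y p n ≠ 0) : Summable (clausenTerm x y p) := by
  have hnum := isBigO_top_comp (one_sub_mul_pow_isBigO_one (x * y) hp) fun k : ℕ => 2 * k
  have hden := (inv_one_sub_mul_pow_isBigO_one hp hx).mul (inv_one_sub_mul_pow_isBigO_one hp hy)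
  have hmain := (isBigO_refl (fun k : ℕ => (x * y) ^ k * p ^ (k ^ 2)) ⊤).norm_right
  refine summable_of_isBigO (summable_norm_pow_mul_pow_sq (x * y) hp) (IsBigO.mono ?_ le_top)
  refine (hmain.mul (hnum.mul hden)).congr (fun k => ?_) fun k => by simp
  rw [clausenTerm, div_eq_mul_inv, mul_inv]
  ring

theorem hasSum_clausenTerm (hp : ‖p‖ < 1) (hx : ‖x‖ < 1) (hy : ∀ n, qPoch y p n ≠ 0) :
    HasSum (clausenTerm x y p) (lambertSeries x y p) := by
  have hrem : Tendsto (fun N : ℕ => (x * y) ^ N * p ^ (N ^ 2) *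
      lambertSeries (x * p ^ N) (y * p ^ N) p) atTop (𝓝 0) :=
    (summable_norm_pow_mul_pow_sq (x * y) hp).of_norm.tendsto_atTop_zero.zero_mul_isBoundedUnder_le
      (((isBigO_one_iff ℝ).1 (lambertSeries_mul_pow_isBigO_one hp hx hy)).mono le_top)
  refine (summable_clausenTerm hp (qPoch_ne_zero hx hp) hy).hasSum_iff_tendsto_nat.2 ?_
  simpa only [← eq_sub_of_add_eq (sum_clausenTerm_add hp hx hy _), sub_zero] using
    hrem.const_sub (lambertSeries x y p)

/-- The `k`-th term of the alternating expansion of `lambertSeries x y p` in shifted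
factorials. -/
noncomputable def altLambertTerm (x y p : ℂ) (k : ℕ) : ℂ :=
  (-1) ^ k * p ^ (k.choose 2) * qPoch p p k * (x * y) ^ k / (qPoch x p (k + 1) * qPoch y p (k + 1))

lemma altLambertTerm_mul_pow_isBigO (hp : ‖p‖ < 1) (hx : ∀ n, qPoch x p n ≠ 0)
    (hy : ∀ n, qPoch y p n ≠ 0) :
    (fun z : ℕ × ℕ => altLambertTerm x (y * p ^ z.1) p z.2)
      =O[⊤] fun z => (‖x‖ * ‖y‖) ^ z.2 * ‖p‖ ^ (z.2.choose 2) := by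
  have hmain : (fun z : ℕ × ℕ => (-1) ^ z.2 * p ^ (z.2.choose 2) * (x * (y * p ^ z.1)) ^ z.2)
      =O[⊤] fun z => (‖x‖ * ‖y‖) ^ z.2 * ‖p‖ ^ (z.2.choose 2) := by
    refine isBigO_of_le ⊤ fun z => ?_
    simp only [norm_mul, norm_pow, norm_neg, norm_one, one_pow, one_mul, norm_norm]
    rw [mul_comm]
    gcongr
    exact mul_le_of_le_one_right (norm_nonneg y) (pow_le_one₀ (norm_nonneg p) hp.le)
  have hP := isBigO_top_comp (qPoch_isBigO_one p hp) fun z : ℕ × ℕ => z.2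
  have hX := isBigO_top_comp (inv_qPoch_isBigO_one hp hx) fun z : ℕ × ℕ => z.2 + 1
  have hY := isBigO_top_comp (inv_qPoch_mul_pow_isBigO_one hp hy)
    fun z : ℕ × ℕ => (z.1, z.2 + 1)
  refine (hmain.mul (hP.mul (hX.mul hY))).congr (fun z => ?_) fun z => by simp
  rw [altLambertTerm, div_eq_mul_inv, mul_inv]
  ring

lemma summable_altLambertTerm (hp : ‖p‖ < 1) (hx : ∀ n, qPoch x p n ≠ 0)
    (hy : ∀ n, qPoch y p n ≠ 0) : Summable (altLambertTerm x y p) := by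
  refine summable_of_isBigO (summable_pow_mul_pow_choose_two (‖x‖ * ‖y‖) (norm_nonneg p) hp) ?_
  simpa using (isBigO_top_comp (altLambertTerm_mul_pow_isBigO hp hx hy)
    fun k : ℕ => (0, k)).mono le_top

lemma altLambertTerm_succ (x y p : ℂ) (k : ℕ) :
    altLambertTerm x y p (k + 1) = altLambertTerm x y p k *
      (-(p ^ k * (1 - p ^ (k + 1)) * (x * y))
        / ((1 - x * p ^ (k + 1)) * (1 - y * p ^ (k + 1)))) := by
  rw [altLambertTerm, altLambertTerm, Nat.choose_succ_succ' k 1, Nat.choose_one_right,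
    qPoch_succ p, qPoch_succ x p (k + 1), qPoch_succ y p (k + 1), div_mul_div_comm]
  congr 1 <;> ring

lemma altLambertTerm_mul_right (x : ℂ) (hy : ∀ n, qPoch y p n ≠ 0) (k : ℕ) :
    altLambertTerm x (y * p) p k
      = altLambertTerm x y p k * (p ^ k * (1 - y) / (1 - y * p ^ (k + 1))) := by
  have hy1 : 1 - y ≠ 0 := by simpa using one_sub_mul_pow_ne_zero_of_qPoch hy 0
  have hYp : qPoch (y * p) p (k + 1) = qPoch y p (k + 1) * (1 - y * p ^ (k + 1)) / (1 - y) := by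
    rw [eq_div_iff hy1, ← qPoch_succ, qPoch_succ' y]
    ring
  rw [altLambertTerm, altLambertTerm, hYp, ← mul_assoc x, mul_pow (x * y) p]
  field_simp

lemma sum_altLambertTerm_sub (hx : ∀ n, qPoch x p n ≠ 0) (hy : ∀ n, qPoch y p n ≠ 0) (N : ℕ) :
    ∑ k ∈ Finset.range N, (altLambertTerm x y p k - x * altLambertTerm x (y * p) p k)
      = 1 / (1 - y) - (1 - x * p ^ N) * altLambertTerm x y p N := by
  induction N with
  | zero =>
    have hx1 : 1 - x ≠ 0 := by simpa using one_sub_mul_pow_ne_zero_of_qPoch hx 0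
    simp [altLambertTerm, qPoch_succ, div_eq_mul_inv, mul_left_comm (1 - x),
      mul_inv_cancel₀ hx1]
  | succ N ih =>
    have := one_sub_mul_pow_ne_zero_of_qPoch hx (N + 1)
    have := one_sub_mul_pow_ne_zero_of_qPoch hy (N + 1)
    rw [Finset.sum_range_succ, ih, altLambertTerm_mul_right x hy, altLambertTerm_succ]
    field_simp
    ring

lemma tsum_altLambertTerm_sub (hp : ‖p‖ < 1) (hx : ∀ n, qPoch x p n ≠ 0)
    (hy : ∀ n, qPoch y p n ≠ 0) :
    ∑' k, altLambertTerm x y p k - x * ∑' k, altLambertTerm x (y * p) p k = 1 / (1 - y) := by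
  have hyp : ∀ n, qPoch (y * p) p n ≠ 0 := by simpa using qPoch_mul_pow_ne_zero hy 1
  have hlim := ((summable_altLambertTerm hp hx hy).hasSum.sub
    ((summable_altLambertTerm hp hx hyp).hasSum.mul_left x)).tendsto_sum_nat
  refine tendsto_nhds_unique hlim ?_
  simp only [sum_altLambertTerm_sub hx hy]
  have hrem := (summable_altLambertTerm hp hx hy).tendsto_atTop_zero
  have hpow := (tendsto_pow_atTop_nhds_zero_of_norm_lt_one hp).const_mul x
  simpa using ((hpow.const_sub 1).mul hrem).const_sub (1 / (1 - y))

theorem hasSum_altLambertTerm (hp : ‖p‖ < 1) (hx : ‖x‖ < 1) (hy : ∀ n, qPoch y p n ≠ 0) :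
    HasSum (altLambertTerm x y p) (lambertSeries x y p) := by
  have hx0 : ∀ n, qPoch x p n ≠ 0 := qPoch_ne_zero hx hp
  have partial_sum : ∀ M : ℕ, ∑ m ∈ Finset.range M, x ^ m / (1 - y * p ^ m)
      = ∑' k, altLambertTerm x y p k - x ^ M * ∑' k, altLambertTerm x (y * p ^ M) p k := by
    intro M
    induction M with
    | zero => simp
    | succ M ih =>
      have step := tsum_altLambertTerm_sub hp hx0 (qPoch_mul_pow_ne_zero hy M)
      rw [mul_assoc y, ← pow_succ] at step
      rw [Finset.sum_range_succ, ih]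
      linear_combination -x ^ M * step
  have hbdd := tsum_isBigO_one_of_isBigO (f := fun M => altLambertTerm x (y * p ^ M) p)
    (summable_pow_mul_pow_choose_two (‖x‖ * ‖y‖) (norm_nonneg p) hp)
    (altLambertTerm_mul_pow_isBigO hp hx0 hy)
  have hrem := (tendsto_pow_atTop_nhds_zero_of_norm_lt_one hx).zero_mul_isBoundedUnder_le
    (((isBigO_one_iff ℝ).1 hbdd).mono le_top)
  have hlim := (summable_lambertSeries hp hx hy).hasSum.tendsto_sum_nat
  simp only [partial_sum] at hlim
  have htsum := tendsto_nhds_unique hlim (hrem.const_sub (∑' k, altLambertTerm x y p k))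
  rw [sub_zero] at htsum
  rw [lambertSeries, htsum]
  exact (summable_altLambertTerm hp hx0 hy).hasSum

end Lambert

/-! ### Rogers' sum -/

/-- The product `(a - 1)(a - p) ⋯ (a - p^(n-1))`. For `c ≠ 0` it encodes the ratio
`(c;p)_n / c^n` as `qFalling c⁻¹ p n`, and it stays meaningful in the limit `c → ∞`. -/
noncomputable def qFalling (a p : ℂ) (n : ℕ) : ℂ :=
  ∏ i ∈ Finset.range n, (a - p ^ i)

@[simp] lemma qFalling_zero (a p : ℂ) : qFalling a p 0 = 1 := by simp [qFalling]

lemma qFalling_succ (a p : ℂ) (n : ℕ) : qFalling a p (n + 1) = qFalling a p n * (a - p ^ n) :=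
  Finset.prod_range_succ _ n

lemma qFalling_pow_eq_zero (p : ℂ) {n r : ℕ} (h : n < r) : qFalling (p ^ n) p r = 0 :=
  Finset.prod_eq_zero (Finset.mem_range.2 h) (sub_self _)

lemma qFalling_zero_left (p : ℂ) (n : ℕ) : qFalling 0 p n = (-1) ^ n * p ^ (n.choose 2) := by
  induction n with
  | zero => simp
  | succ n ih =>
    rw [qFalling_succ, ih, Nat.choose_succ_succ' n 1, Nat.choose_one_right]
    ring

lemma qFalling_inv {c : ℂ} (hc : c ≠ 0) (p : ℂ) (n : ℕ) :
    qFalling c⁻¹ p n = qPoch c p n / c ^ n := by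
  induction n with
  | zero => simp
  | succ n ih => rw [qFalling_succ, qPoch_succ, ih]; field_simp; ring

lemma qFalling_neg_one_succ (p : ℂ) (n : ℕ) :
    qFalling (-1) p (n + 1) = (-1) ^ (n + 1) * (2 * qPoch (-p) p n) := by
  simpa [qPoch_succ', div_eq_mul_inv, ← inv_pow, mul_comm, one_add_one_eq_two] using
    qFalling_inv (neg_ne_zero.2 one_ne_zero) p (n + 1)

lemma qFalling_mul_left_succ (a p : ℂ) (n : ℕ) :
    qFalling (p * a) p (n + 1) = (p * a - 1) * p ^ n * qFalling a p n := by
  induction n with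
  | zero => simp [qFalling_succ]
  | succ n ih => rw [qFalling_succ, ih, qFalling_succ a]; ring

lemma qFalling_pow_add (p : ℂ) (r m : ℕ) :
    qFalling (p ^ (r + m)) p r * qPoch p p m
      = (-1) ^ r * p ^ (r.choose 2) * qPoch p p (r + m) := by
  induction r generalizing m with
  | zero => simp
  | succ r ih =>
    have h := ih (m + 1)
    rw [show r + (m + 1) = r + 1 + m by ring, qPoch_succ p p m] at h
    rw [qFalling_succ, Nat.choose_succ_succ' r 1, Nat.choose_one_right]
    linear_combination -p ^ r * h

lemma norm_qFalling_le (a : ℂ) {p : ℂ} (hp : ‖p‖ < 1) (n : ℕ) :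
    ‖qFalling a p n‖ ≤ (‖a‖ + 1) ^ n := by
  have hfactor : ∀ i : ℕ, ‖a - p ^ i‖ ≤ ‖a‖ + 1 := fun i => (norm_sub_le _ _).trans <| by
    rw [norm_pow]
    gcongr
    exact pow_le_one₀ (norm_nonneg p) hp.le
  simpa [qFalling, norm_prod] using
    Finset.prod_le_prod (s := Finset.range n) (fun _ _ => norm_nonneg _) fun i _ => hfactor i

lemma norm_qFalling_pow_le {p : ℂ} (hp : ‖p‖ < 1) (n r : ℕ) :
    ‖qFalling (p ^ n) p r‖ ≤ 2 ^ r * ‖p‖ ^ (r.choose 2) := by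
  induction r with
  | zero => simp
  | succ r ih =>
    rcases lt_or_ge n (r + 1) with h | h
    · rw [qFalling_pow_eq_zero p h, norm_zero]
      positivity
    · have hfactor : ‖p ^ n - p ^ r‖ ≤ 2 * ‖p‖ ^ r := by
        refine (norm_sub_le _ _).trans ?_
        rw [norm_pow, norm_pow, two_mul]
        gcongr ?_ + _
        exact pow_le_pow_of_le_one (norm_nonneg p) hp.le (by lia)
      rw [qFalling_succ, norm_mul, Nat.choose_succ_succ' r 1, Nat.choose_one_right]
      calc _ ≤ (2 ^ r * ‖p‖ ^ (r.choose 2)) * (2 * ‖p‖ ^ r) := by gcongr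
        _ = _ := by ring

section Rogers

variable {x p B C E : ℂ}

/-- The part of `rogersTerm` that does not depend on the parameter `E`. -/
noncomputable def rogersCoeff (x p B C : ℂ) (r : ℕ) : ℂ :=
  (1 - x * p ^ (2 * r + 1)) * qPoch x p r * x ^ (r + 1) *
      (qFalling B p (r + 1) * qFalling C p (r + 1)) /
    (qPoch p p (r + 1) * qPoch (x * B) p (r + 1) * qPoch (x * C) p (r + 1))

/-- The term of index `r + 1` of the very-well-poised `₆φ₅` series with parameters
`a = x / p` and `b, c, d`, written in terms of `B = 1/b`, `C = 1/c`, `E = 1/d` so that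
parameters may be sent to infinity. -/
noncomputable def rogersTerm (x p B C E : ℂ) (r : ℕ) : ℂ :=
  rogersCoeff x p B C r * (qFalling E p (r + 1) / qPoch (x * E) p (r + 1))

/-- The common factor of `rogersTerm x p B C E R` and `rogersTerm x p B C (p * E) R`; times `E`
it is the certificate that makes their contiguous relation telescope. -/
noncomputable def rogersWeight (x p B C E : ℂ) (R : ℕ) : ℂ :=
  qPoch x p R * x ^ (R + 1) * qFalling B p (R + 1) * qFalling C p (R + 1) * qFalling E p R *
      (1 - x * E) /
    (qPoch p p R * qPoch (x * B) p R * qPoch (x * C) p R * qPoch (x * E) p (R + 1))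

lemma rogersTerm_eq_rogersWeight (x p B C E : ℂ) (R : ℕ) :
    (1 - x * E) * rogersTerm x p B C E R
      = rogersWeight x p B C E R * (1 - x * p ^ (2 * R + 1)) * (E - p ^ R)
        / ((1 - p * p ^ R) * (1 - x * B * p ^ R) * (1 - x * C * p ^ R)) := by
  rw [rogersTerm, rogersCoeff, rogersWeight, qFalling_succ E, qPoch_succ p, qPoch_succ (x * B),
    qPoch_succ (x * C)]
  simp only [div_eq_mul_inv, mul_inv]
  ring

lemma rogersTerm_mul_left_eq_rogersWeight (hE : 1 - x * E ≠ 0) (p B C : ℂ) (R : ℕ) :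
    rogersTerm x p B C (p * E) R
      = rogersWeight x p B C E R * (1 - x * p ^ (2 * R + 1)) * (p * E - 1) * p ^ R
        / ((1 - p * p ^ R) * (1 - x * B * p ^ R) * (1 - x * C * p ^ R)
          * (1 - x * E * p ^ (R + 1))) := by
  have hpE : qPoch (x * (p * E)) p (R + 1)
      = qPoch (x * E) p (R + 1) * (1 - x * E * p ^ (R + 1)) / (1 - x * E) := by
    rw [← qPoch_succ, qPoch_succ' (x * E), mul_div_cancel_left₀ _ hE, mul_left_comm, mul_comm p]
  rw [rogersTerm, rogersCoeff, rogersWeight, qFalling_mul_left_succ, hpE, qPoch_succ p,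
    qPoch_succ (x * B), qPoch_succ (x * C)]
  simp only [div_eq_mul_inv, mul_inv, inv_inv]
  ring

lemma rogersWeight_succ (x p B C E : ℂ) (R : ℕ) :
    rogersWeight x p B C E (R + 1)
      = rogersWeight x p B C E R * x * (1 - x * p ^ R) * (B - p ^ (R + 1)) * (C - p ^ (R + 1))
        * (E - p ^ R) / ((1 - p * p ^ R) * (1 - x * B * p ^ R) * (1 - x * C * p ^ R)
          * (1 - x * E * p ^ (R + 1))) := by
  rw [rogersWeight, rogersWeight, qPoch_succ x, qFalling_succ E, qFalling_succ B p (R + 1),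
    qFalling_succ C p (R + 1), qPoch_succ p, qPoch_succ (x * B), qPoch_succ (x * C),
    qPoch_succ (x * E) p (R + 1)]
  simp only [div_eq_mul_inv, mul_inv]
  ring

lemma rogersTerm_sub_rogersTerm (hp : ‖p‖ < 1) (hB : ∀ n, qPoch (x * B) p n ≠ 0)
    (hC : ∀ n, qPoch (x * C) p n ≠ 0) (hE : ∀ n, qPoch (x * E) p n ≠ 0) (R : ℕ) :
    (1 - x * E) * (1 - x * B * C * E) * rogersTerm x p B C E R
        - (1 - x * B * E) * (1 - x * C * E) * rogersTerm x p B C (p * E) R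
      = E * rogersWeight x p B C E R - E * rogersWeight x p B C E (R + 1) := by
  have hE1 : 1 - x * E ≠ 0 := by simpa using one_sub_mul_pow_ne_zero_of_qPoch hE 0
  have hp' := one_sub_mul_pow_ne_zero_of_qPoch (qPoch_ne_zero hp hp) R
  have hB' := one_sub_mul_pow_ne_zero_of_qPoch hB R
  have hC' := one_sub_mul_pow_ne_zero_of_qPoch hC R
  have hE' := one_sub_mul_pow_ne_zero_of_qPoch hE (R + 1)
  rw [mul_right_comm, rogersTerm_eq_rogersWeight, rogersTerm_mul_left_eq_rogersWeight hE1,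
    rogersWeight_succ]
  generalize hu : 1 - p * p ^ R = u at *
  generalize hv : 1 - x * B * p ^ R = v at *
  generalize hw : 1 - x * C * p ^ R = w at *
  generalize hs : 1 - x * E * p ^ (R + 1) = s at *
  field_simp
  rw [← hu, ← hv, ← hw, ← hs]
  ring

lemma sum_rogersTerm_sub_sum_rogersTerm (hp : ‖p‖ < 1) (hB : ∀ n, qPoch (x * B) p n ≠ 0)
    (hC : ∀ n, qPoch (x * C) p n ≠ 0) (hE : ∀ n, qPoch (x * E) p n ≠ 0) (R : ℕ) :
    (1 - x * E) * (1 - x * B * C * E) * (1 + ∑ r ∈ Finset.range R, rogersTerm x p B C E r)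
        - (1 - x * B * E) * (1 - x * C * E) *
          (1 + ∑ r ∈ Finset.range R, rogersTerm x p B C (p * E) r)
      = -(E * rogersWeight x p B C E R) := by
  induction R with
  | zero =>
    have hE1 : 1 - x * E ≠ 0 := by simpa using one_sub_mul_pow_ne_zero_of_qPoch hE 0
    simp only [rogersWeight, qFalling_succ, qPoch_succ, qFalling_zero, qPoch_zero,
      Finset.range_zero, Finset.sum_empty, pow_zero, one_mul, mul_one, zero_add, pow_one,
      mul_div_cancel_right₀ _ hE1]
    ring
  | succ R ih =>
    rw [Finset.sum_range_succ, Finset.sum_range_succ]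
    linear_combination ih + rogersTerm_sub_rogersTerm hp hB hC hE R

theorem qPoch_mul_one_add_tsum_rogersTerm (hp : ‖p‖ < 1) (hx : ∀ n, qPoch x p n ≠ 0)
    (hB : ∀ n, qPoch (x * B) p n ≠ 0) (hC : ∀ n, qPoch (x * C) p n ≠ 0) (n : ℕ) :
    qPoch (x * B) p n * qPoch (x * C) p n * (1 + ∑' r, rogersTerm x p B C (p ^ n) r)
      = qPoch x p n * qPoch (x * B * C) p n := by
  have finite : ∀ n R, n ≤ R → ∑' r, rogersTerm x p B C (p ^ n) r
      = ∑ r ∈ Finset.range R, rogersTerm x p B C (p ^ n) r := fun n R hnR =>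
    tsum_eq_sum fun r hr => by
      have : n < r + 1 := by simp only [Finset.mem_range, not_lt] at hr; lia
      simp [rogersTerm, qFalling_pow_eq_zero p this]
  induction n with
  | zero => rw [finite 0 0 le_rfl]; simp
  | succ n ih =>
    have step := sum_rogersTerm_sub_sum_rogersTerm hp hB hC (qPoch_mul_pow_ne_zero hx n) (n + 1)
    have weight_zero : rogersWeight x p B C (p ^ n) (n + 1) = 0 := by
      simp [rogersWeight, qFalling_pow_eq_zero p n.lt_succ_self]
    rw [weight_zero, mul_zero, neg_zero, ← pow_succ', ← finite n _ n.le_succ,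
      ← finite _ _ le_rfl] at step
    simp only [qPoch_succ]
    linear_combination (1 - x * p ^ n) * (1 - x * B * C * p ^ n) * ih
      - qPoch (x * B) p n * qPoch (x * C) p n * step

lemma rogersCoeff_isBigO (hp : ‖p‖ < 1) (hB : ∀ n, qPoch (x * B) p n ≠ 0)
    (hC : ∀ n, qPoch (x * C) p n ≠ 0) :
    rogersCoeff x p B C =O[⊤] fun r => (‖x‖ * (‖B‖ + 1) * (‖C‖ + 1)) ^ (r + 1) := by
  have hmain : (fun r => x ^ (r + 1) * (qFalling B p (r + 1) * qFalling C p (r + 1)))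
      =O[⊤] fun r => (‖x‖ * (‖B‖ + 1) * (‖C‖ + 1)) ^ (r + 1) := by
    refine isBigO_of_le' (c := 1) ⊤ fun r => ?_
    rw [one_mul, mul_assoc ‖x‖, mul_pow, mul_pow, norm_mul, norm_mul, norm_pow,
      Real.norm_of_nonneg (by positivity)]
    gcongr
    exacts [norm_qFalling_le B hp _, norm_qFalling_le C hp _]
  have hnum := (isBigO_top_comp (one_sub_mul_pow_isBigO_one x hp) fun r => 2 * r + 1).mul
    (qPoch_isBigO_one x hp)
  have hden := (inv_qPoch_isBigO_one hp (qPoch_ne_zero hp hp)).mul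
    ((inv_qPoch_isBigO_one hp hB).mul (inv_qPoch_isBigO_one hp hC))
  have hden' := isBigO_top_comp hden fun r => r + 1
  refine (hmain.mul (hnum.mul hden')).congr (fun r => ?_) fun r => by simp
  rw [rogersCoeff]
  simp only [div_eq_mul_inv, mul_inv]
  ring

lemma rogersTerm_pow_isBigO (hp : ‖p‖ < 1) (hx : ∀ n, qPoch x p n ≠ 0)
    (hB : ∀ n, qPoch (x * B) p n ≠ 0) (hC : ∀ n, qPoch (x * C) p n ≠ 0) :
    (fun z : ℕ × ℕ => rogersTerm x p B C (p ^ z.1) z.2) =O[⊤] fun z =>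
      (‖x‖ * (‖B‖ + 1) * (‖C‖ + 1) * 2) ^ (z.2 + 1) * ‖p‖ ^ ((z.2 + 1).choose 2) := by
  have hcoeff := isBigO_top_comp (rogersCoeff_isBigO hp hB hC) fun z : ℕ × ℕ => z.2
  have hfalling : (fun z : ℕ × ℕ => qFalling (p ^ z.1) p (z.2 + 1))
      =O[⊤] fun z => 2 ^ (z.2 + 1) * ‖p‖ ^ ((z.2 + 1).choose 2) :=
    isBigO_of_le ⊤ fun z => (norm_qFalling_pow_le hp z.1 (z.2 + 1)).trans (le_abs_self _)
  have hden := isBigO_top_comp (inv_qPoch_mul_pow_isBigO_one hp hx)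
    fun z : ℕ × ℕ => (z.1, z.2 + 1)
  refine (hcoeff.mul (hfalling.mul hden)).congr (fun z => ?_) fun z => by
    rw [mul_one, mul_pow _ (2 : ℝ), ← mul_assoc]
  rw [rogersTerm, div_eq_mul_inv]

lemma summable_pow_succ_mul_pow_choose_two (K : ℝ) {t : ℝ} (h0 : 0 ≤ t) (h1 : t < 1) :
    Summable fun n : ℕ => K ^ (n + 1) * t ^ ((n + 1).choose 2) :=
  (summable_nat_add_iff (f := fun n => K ^ n * t ^ (n.choose 2)) 1).2
    (summable_pow_mul_pow_choose_two K h0 h1)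

lemma summable_rogersTerm_zero (hp : ‖p‖ < 1) (hB : ∀ n, qPoch (x * B) p n ≠ 0)
    (hC : ∀ n, qPoch (x * C) p n ≠ 0) : Summable (rogersTerm x p B C 0) := by
  have hfalling : (fun r => qFalling 0 p (r + 1)) =O[⊤] fun r => ‖p‖ ^ ((r + 1).choose 2) :=
    isBigO_of_le ⊤ fun r => by simp [qFalling_zero_left]
  have hterm := ((rogersCoeff_isBigO hp hB hC).mul hfalling).mono (le_top : atTop ≤ ⊤)
  refine (summable_of_isBigO_nat
    (summable_pow_succ_mul_pow_choose_two _ (norm_nonneg p) hp) hterm).congr fun r => ?_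
  rw [rogersTerm, mul_zero, qPoch_zero_left, div_one]

lemma tendsto_rogersTerm_pow (hp : ‖p‖ < 1) (x B C : ℂ) (r : ℕ) :
    Tendsto (fun n : ℕ => rogersTerm x p B C (p ^ n) r) atTop (𝓝 (rogersTerm x p B C 0 r)) := by
  have hcont : ContinuousAt (fun E => rogersTerm x p B C E r) 0 := by
    have hnum : Continuous fun E => qFalling E p (r + 1) := by unfold qFalling; fun_prop
    have hden : Continuous fun E => qPoch (x * E) p (r + 1) := by unfold qPoch; fun_prop
    exact continuousAt_const.mul (hnum.continuousAt.div hden.continuousAt (by simp))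
  exact hcont.tendsto.comp (tendsto_pow_atTop_nhds_zero_of_norm_lt_one hp)

theorem qPochInf_mul_one_add_tsum_rogersTerm (hp : ‖p‖ < 1) (hx : ∀ n, qPoch x p n ≠ 0)
    (hB : ∀ n, qPoch (x * B) p n ≠ 0) (hC : ∀ n, qPoch (x * C) p n ≠ 0) :
    qPochInf (x * B) p * qPochInf (x * C) p * (1 + ∑' r, rogersTerm x p B C 0 r)
      = qPochInf x p * qPochInf (x * B * C) p := by
  obtain ⟨M, hM⟩ := isBigO_top.1 (rogersTerm_pow_isBigO hp hx hB hC)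
  have htannery : Tendsto (fun n : ℕ => ∑' r, rogersTerm x p B C (p ^ n) r) atTop
      (𝓝 (∑' r, rogersTerm x p B C 0 r)) :=
    tendsto_tsum_of_dominated_convergence
      ((summable_pow_succ_mul_pow_choose_two _ (norm_nonneg p) hp).norm.mul_left M)
      (tendsto_rogersTerm_pow hp x B C) (Eventually.of_forall fun n r => hM (n, r))
  have hleft := ((tendsto_qPoch (x * B) hp).mul (tendsto_qPoch (x * C) hp)).mul
    (htannery.const_add 1)
  simp only [qPoch_mul_one_add_tsum_rogersTerm hp hx hB hC] at hleft
  exact tendsto_nhds_unique hleft ((tendsto_qPoch x hp).mul (tendsto_qPoch (x * B * C) hp))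

end Rogers

/-! ### The square of the theta function -/

section Theta

variable {p q : ℂ}

lemma hasSum_pow_sq (hq : ‖q‖ < 1) :
    HasSum (fun n : ℤ => q ^ (n ^ 2)) (1 + 2 * ∑' r : ℕ, q ^ ((r + 1) ^ 2)) := by
  have hnat : Summable fun n : ℕ => q ^ (n ^ 2) := by
    simpa using (summable_norm_pow_mul_pow_sq 1 hq).of_norm
  have hcast : ∀ n : ℕ, q ^ ((n : ℤ) ^ 2) = q ^ (n ^ 2) := fun n => by
    rw [← zpow_natCast, Nat.cast_pow]
  have hsum : Summable fun n : ℤ => q ^ (n ^ 2) :=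
    .of_nat_of_neg (by simpa [hcast] using hnat) (by simpa [hcast] using hnat)
  have heven : (fun n : ℤ => q ^ (n ^ 2)).Even := fun n => by simp
  convert hsum.hasSum using 1
  rw [tsum_int_eq_zero_add_two_mul_tsum_pnat heven hsum, tsum_pnat_eq_tsum_succ
    (f := fun n : ℕ => q ^ ((n : ℤ) ^ 2))]
  simp [← hcast]

lemma ramanujanPhi_eq (hq : ‖q‖ < 1) :
    ramanujanPhi q = 1 + 2 * ∑' r : ℕ, q ^ ((r + 1) ^ 2) :=
  (hasSum_pow_sq hq).tsum_eq

lemma qPochInf_zero_left (p : ℂ) : qPochInf 0 p = 1 := by simp [qPochInf]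

lemma one_sub_mul_pow_two_mul_add_one (p : ℂ) (r : ℕ) :
    1 - p * p ^ (2 * r + 1) = (1 - p * p ^ r) * (1 - -p * p ^ r) := by
  ring

lemma qPoch_neg_ne_zero (hp : ‖p‖ < 1) (n : ℕ) : qPoch (-p) p n ≠ 0 :=
  qPoch_ne_zero (norm_neg p ▸ hp) hp n

lemma rogersTerm_self_neg_one_zero (hp : ‖p‖ < 1) (r : ℕ) :
    rogersTerm p p (-1) 0 0 r = 2 * (-p) ^ ((r + 1) ^ 2) := by
  have hsign : (-1 : ℂ) ^ ((r + 1) ^ 2) = (-1) ^ (r + 1) :=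
    neg_one_pow_congr (by simp [Nat.even_pow])
  have hP := qPoch_ne_zero hp hp r
  have hN := qPoch_neg_ne_zero hp r
  have hP' := one_sub_mul_pow_ne_zero_of_qPoch (qPoch_ne_zero hp hp) r
  have hN' := one_sub_mul_pow_ne_zero_of_qPoch (qPoch_neg_ne_zero hp) r
  rw [neg_pow, hsign, ← two_mul_choose_two_add, rogersTerm, rogersCoeff,
    one_sub_mul_pow_two_mul_add_one, qFalling_neg_one_succ, qFalling_zero_left, mul_zero,
    qPoch_zero_left, mul_neg_one, qPoch_succ p, qPoch_succ (-p)]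
  generalize 1 - p * p ^ r = u at *
  generalize 1 - -p * p ^ r = v at *
  field_simp
  rw [pow_right_comm (-1 : ℂ), neg_one_sq, one_pow]
  ring

lemma rogersTerm_self_neg_one_neg_one (hp : ‖p‖ < 1) (r : ℕ) :
    rogersTerm p p (-1) (-1) 0 r
      = 4 * ((-1) ^ (r + 1) * p ^ ((r + 2).choose 2) / (1 + p ^ (r + 1))) := by
  have hP := qPoch_ne_zero hp hp r
  have hN := qPoch_neg_ne_zero hp r
  have hP' := one_sub_mul_pow_ne_zero_of_qPoch (qPoch_ne_zero hp hp) r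
  have hN' := one_sub_mul_pow_ne_zero_of_qPoch (qPoch_neg_ne_zero hp) r
  have hv : 1 + p ^ (r + 1) = 1 - -p * p ^ r := by ring
  rw [rogersTerm, rogersCoeff, one_sub_mul_pow_two_mul_add_one, Nat.choose_succ_succ' (r + 1) 1,
    Nat.choose_one_right, hv, qFalling_neg_one_succ, qFalling_zero_left, mul_zero,
    qPoch_zero_left, mul_neg_one, qPoch_succ p, qPoch_succ (-p)]
  generalize 1 - p * p ^ r = u at *
  generalize 1 - -p * p ^ r = v at *
  field_simp
  rw [pow_right_comm (-1 : ℂ), neg_one_sq, one_pow]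
  ring

theorem qPochInf_neg_mul_ramanujanPhi_neg (hp : ‖p‖ < 1) :
    qPochInf (-p) p * ramanujanPhi (-p) = qPochInf p p := by
  have h := qPochInf_mul_one_add_tsum_rogersTerm (x := p) (B := -1) (C := 0) hp
    (qPoch_ne_zero hp hp) (by simpa using qPoch_neg_ne_zero hp) (by simp)
  simpa only [rogersTerm_self_neg_one_zero hp, tsum_mul_left, mul_neg_one, mul_zero,
    qPochInf_zero_left, mul_one, ← ramanujanPhi_eq (norm_neg p ▸ hp : ‖-p‖ < 1)] using h

theorem ramanujanPhi_neg_sq (hp : ‖p‖ < 1) :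
    ramanujanPhi (-p) ^ 2
      = 1 + 4 * ∑' r : ℕ, (-1) ^ (r + 1) * p ^ ((r + 2).choose 2) / (1 + p ^ (r + 1)) := by
  have hN := qPochInf_ne_zero hp (qPoch_neg_ne_zero hp)
  have h := qPochInf_mul_one_add_tsum_rogersTerm (x := p) (B := -1) (C := -1) hp
    (qPoch_ne_zero hp hp) (by simpa using qPoch_neg_ne_zero hp)
    (by simpa using qPoch_neg_ne_zero hp)
  simp only [rogersTerm_self_neg_one_neg_one hp, tsum_mul_left, mul_neg_one, neg_neg,
    ← qPochInf_neg_mul_ramanujanPhi_neg hp] at h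
  refine mul_left_cancel₀ (mul_ne_zero hN hN) ?_
  linear_combination -h

lemma consecutive_terms_eq_clausenTerm (hp : ‖p‖ < 1) (k : ℕ) :
    (-1) ^ (2 * k + 1) * p ^ ((2 * k + 2).choose 2) / (1 + p ^ (2 * k + 1))
        + (-1) ^ (2 * k + 2) * p ^ ((2 * k + 3).choose 2) / (1 + p ^ (2 * k + 2))
      = -p * clausenTerm (-p) (-p ^ 2) (p ^ 2) k := by
  have h₁ := one_sub_mul_pow_ne_zero_of_qPoch (qPoch_neg_ne_zero hp) (2 * k)
  have h₂ := one_sub_mul_pow_ne_zero_of_qPoch (qPoch_neg_ne_zero hp) (2 * k + 1)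
  have choose₁ : (2 * k + 2).choose 2 = 2 * k ^ 2 + 3 * k + 1 := by
    linarith [two_mul_choose_two_add (2 * k + 2)]
  have choose₂ : (2 * k + 3).choose 2 = 2 * k ^ 2 + 5 * k + 3 := by
    linarith [two_mul_choose_two_add (2 * k + 3)]
  rw [choose₁, choose₂, Odd.neg_one_pow ⟨k, rfl⟩, Even.neg_one_pow ⟨k + 1, by ring⟩, clausenTerm,
    show -p * (p ^ 2) ^ k = -p * p ^ (2 * k) by ring,
    show -p ^ 2 * (p ^ 2) ^ k = -p * p ^ (2 * k + 1) by ring,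
    show 1 + p ^ (2 * k + 1) = 1 - -p * p ^ (2 * k) by ring,
    show 1 + p ^ (2 * k + 2) = 1 - -p * p ^ (2 * k + 1) by ring]
  generalize hu : 1 - -p * p ^ (2 * k) = u at *
  generalize hv : 1 - -p * p ^ (2 * k + 1) = v at *
  field_simp
  rw [← hu, ← hv]
  ring

lemma summable_neg_one_pow_mul_pow_choose_two_div (hp : ‖p‖ < 1) :
    Summable fun r : ℕ => (-1) ^ (r + 1) * p ^ ((r + 2).choose 2) / (1 + p ^ (r + 1)) := by
  have h := summable_rogersTerm_zero (x := p) (B := -1) (C := -1) hp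
    (by simpa using qPoch_neg_ne_zero hp) (by simpa using qPoch_neg_ne_zero hp)
  rw [funext (rogersTerm_self_neg_one_neg_one hp)] at h
  exact (summable_mul_left_iff (by norm_num : (4 : ℂ) ≠ 0)).1 h

theorem ramanujanPhi_neg_sq_eq_lambertSeries (hp : ‖p‖ < 1) :
    ramanujanPhi (-p) ^ 2 = 1 - 4 * p * lambertSeries (-p) (-p ^ 2) (p ^ 2) := by
  have hp2 := norm_pow_lt_one hp two_ne_zero
  let f : ℕ → ℂ := fun r => (-1) ^ (r + 1) * p ^ ((r + 2).choose 2) / (1 + p ^ (r + 1))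
  have hsum : Summable f := summable_neg_one_pow_mul_pow_choose_two_div hp
  have heven : Summable fun k => f (2 * k) :=
    hsum.comp_injective fun _ _ h => by simpa using h
  have hodd : Summable fun k => f (2 * k + 1) :=
    hsum.comp_injective fun _ _ h => by simpa using h
  have hclausen := hasSum_clausenTerm hp2 (norm_neg p ▸ hp : ‖-p‖ < 1) (qPoch_neg_ne_zero hp2)
  have hlambert : ∑' r, f r = -p * lambertSeries (-p) (-p ^ 2) (p ^ 2) := by
    rw [← tsum_even_add_odd heven hodd, ← heven.tsum_add hodd, ← hclausen.tsum_eq, ← tsum_mul_left]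
    exact tsum_congr (consecutive_terms_eq_clausenTerm hp)
  rw [ramanujanPhi_neg_sq hp, hlambert]
  ring

theorem ramanujanPhi_sq (hq : ‖q‖ < 1) :
    ramanujanPhi q ^ 2 = 1 + 4 * (q * lambertSeries q (q ^ 4) (q ^ 4)
      - q ^ 3 * lambertSeries (q ^ 3) (q ^ 4) (q ^ 4)) := by
  have hp := norm_pow_lt_one hq four_ne_zero
  have hq4 := qPoch_ne_zero hp hp
  have split : ∀ m : ℕ, q ^ m / (1 - -q ^ 2 * (q ^ 2) ^ m)
      = q ^ m / (1 - q ^ 4 * (q ^ 4) ^ m)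
        - q ^ 2 * ((q ^ 3) ^ m / (1 - q ^ 4 * (q ^ 4) ^ m)) := fun m => by
    have hfactor : 1 - q ^ 4 * (q ^ 4) ^ m
      = (1 - q ^ 2 * (q ^ 2) ^ m) * (1 - -q ^ 2 * (q ^ 2) ^ m) := by ring
    have h := one_sub_mul_pow_ne_zero_of_qPoch hq4 m
    rw [hfactor] at h ⊢
    obtain ⟨_, _⟩ := mul_ne_zero_iff.1 h
    field_simp
    ring
  have h := ramanujanPhi_neg_sq_eq_lambertSeries (p := -q) (norm_neg q ▸ hq)
  rw [neg_neg, neg_sq] at h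
  rw [h, lambertSeries, tsum_congr split, Summable.tsum_sub
    (summable_lambertSeries hp hq hq4)
    ((summable_lambertSeries hp (norm_pow_lt_one hq three_ne_zero) hq4).mul_left _),
    tsum_mul_left, ← lambertSeries, ← lambertSeries]
  ring

end Theta

/-! ### The `₁φ₁` sum -/

section OnePhiOne

variable {a z p : ℂ}

/-- The term of the series `₁φ₁(a; z a; p, z) = ∑ (a)_m (-1)^m p^(m(m-1)/2) z^m / ((p)_m (z a)_m)`,
whose sum is `(z;p)_r` for `a = p^r`. -/
noncomputable def phiTerm (a z p : ℂ) (m : ℕ) : ℂ :=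
  (-1) ^ m * p ^ (m.choose 2) * z ^ m * qPoch a p m / (qPoch p p m * qPoch (z * a) p m)

lemma phiTerm_succ (a z p : ℂ) (m : ℕ) :
    phiTerm a z p (m + 1) = phiTerm a z p m *
      (-(p ^ m * z * (1 - a * p ^ m)) / ((1 - p ^ (m + 1)) * (1 - z * a * p ^ m))) := by
  rw [phiTerm, phiTerm, Nat.choose_succ_succ' m 1, Nat.choose_one_right, qPoch_succ a,
    qPoch_succ p, qPoch_succ (z * a), div_mul_div_comm]
  congr 1 <;> ring

lemma one_sub_mul_phiTerm_succ (h : 1 - z * a ≠ 0) (p : ℂ) (m : ℕ) :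
    (1 - z * a) * phiTerm a z p (m + 1)
      = phiTerm (a * p) z p m * (-(p ^ m * z * (1 - a)) / (1 - p ^ (m + 1))) := by
  rw [phiTerm, phiTerm, Nat.choose_succ_succ' m 1, Nat.choose_one_right, qPoch_succ' a,
    qPoch_succ p, qPoch_succ' (z * a), div_mul_div_comm, mul_left_comm (qPoch p p m * _),
    mul_div_assoc', mul_div_mul_left _ _ h, mul_assoc z a p]
  congr 1 <;> ring

lemma sum_phiTerm_sub (hp : ‖p‖ < 1) (ha : ∀ n, qPoch (z * a) p n ≠ 0) (N : ℕ) :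
    ∑ m ∈ Finset.range (N + 1), (phiTerm (a * p) z p m - (1 - z * a) * phiTerm a z p m)
      = a * z * p ^ N * phiTerm (a * p) z p N := by
  induction N with
  | zero => simp [phiTerm, mul_comm z a]
  | succ N ih =>
    have hza : 1 - z * a ≠ 0 := by simpa using one_sub_mul_pow_ne_zero_of_qPoch ha 0
    have hp' := one_sub_pow_succ_ne_zero hp N
    have hza' : 1 - z * (a * p) * p ^ N ≠ 0 := by
      have := one_sub_mul_pow_ne_zero_of_qPoch ha (N + 1)
      rwa [pow_succ', ← mul_assoc, mul_assoc z] at this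
    rw [Finset.sum_range_succ, ih, one_sub_mul_phiTerm_succ hza, phiTerm_succ (a * p)]
    generalize hu : 1 - p ^ (N + 1) = u at *
    generalize hv : 1 - z * (a * p) * p ^ N = v at *
    field_simp
    rw [← hu, ← hv]
    ring

lemma phiTerm_isBigO (hp : ‖p‖ < 1) (ha : ∀ n, qPoch (z * a) p n ≠ 0) :
    phiTerm a z p =O[⊤] fun m => ‖z‖ ^ m * ‖p‖ ^ (m.choose 2) := by
  have hmain : (fun m : ℕ => (-1) ^ m * p ^ (m.choose 2) * z ^ m)
      =O[⊤] fun m => ‖z‖ ^ m * ‖p‖ ^ (m.choose 2) :=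
    isBigO_of_le ⊤ fun m => by simp [mul_comm]
  have hquot := (qPoch_isBigO_one a hp).mul ((inv_qPoch_isBigO_one hp (qPoch_ne_zero hp hp)).mul
    (inv_qPoch_isBigO_one hp ha))
  refine (hmain.mul hquot).congr (fun m => ?_) fun m => by simp
  rw [phiTerm, div_eq_mul_inv, mul_inv, ← mul_assoc]

lemma summable_phiTerm (hp : ‖p‖ < 1) (ha : ∀ n, qPoch (z * a) p n ≠ 0) :
    Summable (phiTerm a z p) :=
  summable_of_isBigO (summable_pow_mul_pow_choose_two ‖z‖ (norm_nonneg p) hp)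
    ((phiTerm_isBigO hp ha).mono le_top)

theorem hasSum_phiTerm_pow (hp : ‖p‖ < 1) (hz : ∀ n, qPoch z p n ≠ 0) (r : ℕ) :
    HasSum (phiTerm (p ^ r) z p) (qPoch z p r) := by
  induction r with
  | zero =>
    have tail : ∀ m, m ≠ 0 → phiTerm (p ^ 0) z p m = 0 := fun m hm => by
      obtain ⟨m, rfl⟩ := Nat.exists_eq_succ_of_ne_zero hm
      simp [phiTerm, qPoch_succ']
    simpa [phiTerm] using hasSum_single 0 tail
  | succ r ih =>
    have hzr := qPoch_mul_pow_ne_zero hz r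
    have hsum := summable_phiTerm hp (qPoch_mul_pow_ne_zero hz (r + 1))
    rw [pow_succ] at hsum
    have hpartial := ((hsum.hasSum.sub (ih.mul_left (1 - z * p ^ r))).tendsto_sum_nat).comp
      (tendsto_add_atTop_nat 1)
    simp only [Function.comp_def, sum_phiTerm_sub hp hzr] at hpartial
    have hzero : Tendsto (fun N : ℕ => p ^ r * z * p ^ N * phiTerm (p ^ r * p) z p N) atTop
        (𝓝 0) := by
      simpa using ((tendsto_pow_atTop_nhds_zero_of_norm_lt_one hp).const_mul (p ^ r * z)).mul
        hsum.tendsto_atTop_zero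
    rw [pow_succ, qPoch_succ, mul_comm (qPoch z p r),
      ← sub_eq_zero.1 (tendsto_nhds_unique hpartial hzero)]
    exact hsum.hasSum

end OnePhiOne

/-! ### Bailey's transformation -/

section Bailey

variable {x p B C : ℂ}

/-- The term of index `n + 1` of the series
`∑_{n ≥ 1} (p)_{n-1} (xBC)_n (-1)^n p^(n(n-1)/2) x^n / ((xB)_n (xC)_n (p)_n)`. -/
noncomputable def balancedTerm (x p B C : ℂ) (n : ℕ) : ℂ :=
  qPoch (x * B * C) p (n + 1) * (-1) ^ (n + 1) * p ^ ((n + 1).choose 2) * x ^ (n + 1) /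
    (qPoch (x * B) p (n + 1) * qPoch (x * C) p (n + 1) * (1 - p ^ (n + 1)))

/-- The term of index `r + 1` of the very-well-poised series which Bailey's transformation
associates to `balancedTerm`. -/
noncomputable def wellPoisedTerm (x p B C : ℂ) (r : ℕ) : ℂ :=
  (1 - x * p ^ (2 * r + 1)) * p ^ (r * (r + 1)) * x ^ (2 * (r + 1)) *
      (qFalling B p (r + 1) * qFalling C p (r + 1)) /
    ((1 - p ^ (r + 1)) * (1 - x * p ^ r) * (qPoch (x * B) p (r + 1) * qPoch (x * C) p (r + 1)))

lemma mul_altLambertTerm_self (hp : ‖p‖ < 1) (x : ℂ) (n : ℕ) :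
    x * altLambertTerm x p p n
      = (-1) ^ n * p ^ ((n + 1).choose 2) * x ^ (n + 1) /
        (qPoch x p (n + 1) * (1 - p ^ (n + 1))) := by
  have hP := qPoch_ne_zero hp hp n
  rw [altLambertTerm, qPoch_succ p, Nat.choose_succ_succ' n 1, Nat.choose_one_right,
    mul_left_comm (qPoch x p (n + 1)), mul_right_comm _ (qPoch p p n), mul_comm _ (qPoch p p n),
    mul_div_mul_left _ _ hP, ← pow_succ' p]
  simp only [div_eq_mul_inv, mul_inv]
  ring

lemma choose_two_add_add (n r : ℕ) :
    (n + r).choose 2 = n.choose 2 + r.choose 2 + n * r := by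
  induction r with
  | zero => simp
  | succ r ih =>
    rw [← add_assoc, Nat.choose_succ_succ' _ 1, Nat.choose_succ_succ' r 1, ih,
      Nat.choose_one_right, Nat.choose_one_right]
    ring

lemma qFalling_pow_div_one_sub_pow (hp : ‖p‖ < 1) (r m : ℕ) :
    qFalling (p ^ (m + r + 1)) p (r + 1) / (1 - p ^ (m + r + 1))
      = (-1) ^ (r + 1) * p ^ ((r + 1).choose 2) * (qPoch p p r * qPoch (p ^ (r + 1)) p m)
        / qPoch p p m := by
  rw [div_eq_div_iff (one_sub_pow_succ_ne_zero hp _) (qPoch_ne_zero hp hp m),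
    show m + r + 1 = r + 1 + m by ring, qFalling_pow_add,
    show r + 1 + m = r + m + 1 by ring, qPoch_succ, qPoch_add, ← pow_succ', ← pow_succ']
  ring

lemma mul_altLambertTerm_mul_eq_phiTerm (hp : ‖p‖ < 1) (x : ℂ) (r m : ℕ) :
    x * altLambertTerm x p p (m + r) *
        (qFalling (p ^ (m + r + 1)) p (r + 1) / qPoch (x * p ^ (m + r + 1)) p (r + 1))
      = -(p ^ (r * (r + 1)) * x ^ (r + 1) * qPoch p p r /
          (qPoch x p (r + 1) * qPoch (x * p ^ (r + 1)) p (r + 1))) *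
        phiTerm (p ^ (r + 1)) (x * p ^ (r + 1)) p m := by
  have product : qPoch x p (m + r + 1) * qPoch (x * p ^ (m + r + 1)) p (r + 1)
      = qPoch x p (r + 1) * qPoch (x * p ^ (r + 1)) p (r + 1)
        * qPoch (x * p ^ (r + 1) * p ^ (r + 1)) p m := by
    rw [← qPoch_add, ← qPoch_add, mul_assoc x, ← pow_add, ← qPoch_add]
    congr 1
    ring
  have exponent : (m + r + 1).choose 2 + (r + 1).choose 2
      = m.choose 2 + (r + 1) * m + r * (r + 1) := by
    have := two_mul_choose_two_add (r + 1)
    rw [add_assoc, choose_two_add_add]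
    linarith
  have sign : (-1 : ℂ) ^ (m + r) * (-1) ^ (r + 1) = -(-1) ^ m := by
    rw [← pow_add, show m + r + (r + 1) = m + (2 * r + 1) by ring, pow_add,
      Odd.neg_one_pow ⟨r, rfl⟩, mul_neg_one]
  calc _ = (-1) ^ (m + r) * p ^ ((m + r + 1).choose 2) * x ^ (m + r + 1) *
          (qFalling (p ^ (m + r + 1)) p (r + 1) / (1 - p ^ (m + r + 1))) /
          (qPoch x p (m + r + 1) * qPoch (x * p ^ (m + r + 1)) p (r + 1)) := by
        rw [mul_altLambertTerm_self hp]
        simp only [div_eq_mul_inv, mul_inv]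
        ring
    _ = ((-1) ^ (m + r) * (-1) ^ (r + 1)) * p ^ ((m + r + 1).choose 2 + (r + 1).choose 2) *
          x ^ (m + r + 1) * (qPoch p p r * qPoch (p ^ (r + 1)) p m / qPoch p p m) /
          (qPoch x p (m + r + 1) * qPoch (x * p ^ (m + r + 1)) p (r + 1)) := by
        rw [qFalling_pow_div_one_sub_pow hp]
        ring
    _ = _ := by
        rw [product, sign, exponent, phiTerm]
        simp only [div_eq_mul_inv, mul_inv]
        ring

lemma hasSum_mul_altLambertTerm_mul (hp : ‖p‖ < 1) (hx : ∀ n, qPoch x p n ≠ 0) (r : ℕ) :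
    HasSum (fun n => x * altLambertTerm x p p n *
        (qFalling (p ^ (n + 1)) p (r + 1) / qPoch (x * p ^ (n + 1)) p (r + 1)))
      (-(p ^ (r * (r + 1)) * x ^ (r + 1) * qPoch p p r / qPoch x p (r + 1))) := by
  have hz := qPoch_mul_pow_ne_zero hx (r + 1)
  have initial : ∑ n ∈ Finset.range r, x * altLambertTerm x p p n *
      (qFalling (p ^ (n + 1)) p (r + 1) / qPoch (x * p ^ (n + 1)) p (r + 1)) = 0 :=
    Finset.sum_eq_zero fun n hn => by
      rw [qFalling_pow_eq_zero p (Nat.succ_lt_succ (Finset.mem_range.1 hn)), zero_div, mul_zero]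
  refine (hasSum_nat_add_iff' r).1 ?_
  simp only [initial, sub_zero, mul_altLambertTerm_mul_eq_phiTerm hp]
  have h := (hasSum_phiTerm_pow hp hz (r + 1)).mul_left (-(p ^ (r * (r + 1)) * x ^ (r + 1) *
    qPoch p p r / (qPoch x p (r + 1) * qPoch (x * p ^ (r + 1)) p (r + 1))))
  rwa [neg_mul, div_mul_eq_mul_div, mul_div_mul_right _ _ (hz (r + 1))] at h

lemma hasSum_mul_rogersTerm_column (hp : ‖p‖ < 1) (hx : ∀ n, qPoch x p n ≠ 0) (B C : ℂ) (r : ℕ) :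
    HasSum (fun n => x * altLambertTerm x p p n * rogersTerm x p B C (p ^ (n + 1)) r)
      (-wellPoisedTerm x p B C r) := by
  have hP := qPoch_ne_zero hp hp r
  have hX := hx r
  have value : rogersCoeff x p B C r *
      -(p ^ (r * (r + 1)) * x ^ (r + 1) * qPoch p p r / qPoch x p (r + 1))
        = -wellPoisedTerm x p B C r := by
    rw [wellPoisedTerm, rogersCoeff, qPoch_succ p, qPoch_succ x, ← pow_succ' p, pow_mul' x 2]
    generalize 1 - p ^ (r + 1) = u
    generalize 1 - x * p ^ r = v
    field_simp
  simpa only [rogersTerm, value, mul_left_comm (rogersCoeff x p B C r)] using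
    (hasSum_mul_altLambertTerm_mul hp hx r).mul_left (rogersCoeff x p B C r)

lemma hasSum_mul_rogersTerm_row (hp : ‖p‖ < 1) (hx : ∀ n, qPoch x p n ≠ 0)
    (hB : ∀ n, qPoch (x * B) p n ≠ 0) (hC : ∀ n, qPoch (x * C) p n ≠ 0) (n : ℕ) :
    HasSum (fun r => x * altLambertTerm x p p n * rogersTerm x p B C (p ^ (n + 1)) r)
      (-balancedTerm x p B C n - x * altLambertTerm x p p n) := by
  have hsum : Summable (rogersTerm x p B C (p ^ (n + 1))) :=
    summable_of_isBigO (summable_pow_succ_mul_pow_choose_two _ (norm_nonneg p) hp)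
      ((isBigO_top_comp (rogersTerm_pow_isBigO hp hx hB hC) fun r => (n + 1, r)).mono le_top)
  have hX := hx (n + 1)
  have hXB := hB (n + 1)
  have hXC := hC (n + 1)
  have rogers : 1 + ∑' r, rogersTerm x p B C (p ^ (n + 1)) r = qPoch x p (n + 1) *
      qPoch (x * B * C) p (n + 1) / (qPoch (x * B) p (n + 1) * qPoch (x * C) p (n + 1)) := by
    rw [eq_div_iff (mul_ne_zero hXB hXC), mul_comm, qPoch_mul_one_add_tsum_rogersTerm hp hx hB hC]
  have hp' := one_sub_pow_succ_ne_zero hp n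
  have value : x * altLambertTerm x p p n * ∑' r, rogersTerm x p B C (p ^ (n + 1)) r
      = -balancedTerm x p B C n - x * altLambertTerm x p p n := by
    rw [eq_sub_iff_add_eq, ← mul_add_one, add_comm, rogers,
      mul_altLambertTerm_self hp, balancedTerm]
    generalize 1 - p ^ (n + 1) = u at *
    field_simp
    ring
  exact value ▸ hsum.hasSum.mul_left (x * altLambertTerm x p p n)

lemma summable_mul_rogersTerm (hp : ‖p‖ < 1) (hx : ∀ n, qPoch x p n ≠ 0)
    (hB : ∀ n, qPoch (x * B) p n ≠ 0) (hC : ∀ n, qPoch (x * C) p n ≠ 0) :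
    Summable fun z : ℕ × ℕ =>
      x * altLambertTerm x p p z.1 * rogersTerm x p B C (p ^ (z.1 + 1)) z.2 := by
  have hlambert := ((summable_altLambertTerm hp hx (qPoch_ne_zero hp hp)).mul_left x).norm
  have hrogers := isBigO_top_comp (rogersTerm_pow_isBigO hp hx hB hC)
    fun z : ℕ × ℕ => (z.1 + 1, z.2)
  have hbound := hlambert.mul_of_nonneg
    (summable_pow_succ_mul_pow_choose_two (‖x‖ * (‖B‖ + 1) * (‖C‖ + 1) * 2) (norm_nonneg p) hp)
    (fun _ => norm_nonneg _) (fun _ => by positivity)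
  refine summable_of_isBigO hbound (IsBigO.mono ?_ le_top)
  exact (isBigO_refl (fun z : ℕ × ℕ => x * altLambertTerm x p p z.1) ⊤).norm_right.mul hrogers

lemma summable_wellPoisedTerm (hp : ‖p‖ < 1) (hx : ∀ n, qPoch x p n ≠ 0)
    (hB : ∀ n, qPoch (x * B) p n ≠ 0) (hC : ∀ n, qPoch (x * C) p n ≠ 0) :
    Summable (wellPoisedTerm x p B C) := by
  have h := (summable_mul_rogersTerm hp hx hB hC).prod_symm.hasSum.prod_fiberwise
    (hasSum_mul_rogersTerm_column hp hx B C)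
  simpa using h.summable.neg

theorem hasSum_balancedTerm (hp : ‖p‖ < 1) (hx : ‖x‖ < 1)
    (hB : ∀ n, qPoch (x * B) p n ≠ 0) (hC : ∀ n, qPoch (x * C) p n ≠ 0) :
    HasSum (balancedTerm x p B C)
      (∑' r, wellPoisedTerm x p B C r - x * lambertSeries x p p) := by
  have hx0 := qPoch_ne_zero hx hp
  have hsum := summable_mul_rogersTerm hp hx0 hB hC
  have hrows := hsum.hasSum.prod_fiberwise (hasSum_mul_rogersTerm_row hp hx0 hB hC)
  have hcolumns := ((Equiv.prodComm ℕ ℕ).hasSum_iff.2 hsum.hasSum).prod_fiberwise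
    (hasSum_mul_rogersTerm_column hp hx0 B C)
  have hlambert := (hasSum_altLambertTerm hp hx (qPoch_ne_zero hp hp)).mul_left x
  have total := hcolumns.neg.tsum_eq
  simp only [neg_neg] at total
  simpa only [total, sub_add_cancel, neg_neg, neg_add'] using (hrows.add hlambert).neg

end Bailey

/-! ### The expansions in powers of `q` -/

lemma hasSum_pnat_of_succPNat {M : Type*} [AddCommMonoid M] [TopologicalSpace M] {f : ℕ+ → M}
    {s : M} (h : HasSum (fun n : ℕ => f n.succPNat) s) : HasSum f s :=
  Equiv.pnatEquivNat.symm.hasSum_iff.1 h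

section IntegerPowers

variable {G : Type*} [DivInvMonoid G] {a b : ℕ}

lemma zpow_four_mul_succ (q : G) (n : ℕ) : q ^ (4 * ((n + 1 : ℕ) : ℤ)) = (q ^ 4) ^ (n + 1) := by
  rw [← pow_mul, ← zpow_natCast]
  push_cast
  rfl

lemma zpow_four_mul_succ_sub (q : G) (hab : a + b = 4) (n : ℕ) :
    q ^ (4 * ((n + 1 : ℕ) : ℤ) - b) = q ^ a * (q ^ 4) ^ n := by
  rw [← pow_mul, ← pow_add, ← zpow_natCast]
  congr 1
  zify at hab
  push_cast
  linear_combination -hab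

lemma zpow_eight_mul_succ_sub (q : G) (hab : a + b = 4) (n : ℕ) :
    q ^ (8 * ((n + 1 : ℕ) : ℤ) - b) = q ^ a * (q ^ 4) ^ (2 * n + 1) := by
  rw [← pow_mul, ← pow_add, ← zpow_natCast]
  congr 1
  zify at hab
  push_cast
  linear_combination -hab

lemma zpow_two_mul_succ_sq_sub (q : G) (a n : ℕ) :
    q ^ (2 * ((n + 1 : ℕ) : ℤ) ^ 2 - (2 - a) * ((n + 1 : ℕ) : ℤ))
      = (q ^ 4) ^ ((n + 1).choose 2) * (q ^ a) ^ (n + 1) := by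
  have hchoose := two_mul_choose_two_add (n + 1)
  rw [← pow_mul, ← pow_mul, ← pow_add, ← zpow_natCast]
  congr 1
  zify at hchoose
  push_cast at hchoose ⊢
  linear_combination -2 * hchoose

lemma zpow_four_mul_succ_sq_sub (q : G) (hab : a + b = 4) (n : ℕ) :
    q ^ (4 * ((n + 1 : ℕ) : ℤ) ^ 2 - b * ((n + 1 : ℕ) : ℤ))
      = (q ^ 4) ^ (n * (n + 1)) * (q ^ a) ^ (n + 1) := by
  rw [← pow_mul, ← pow_mul, ← pow_add, ← zpow_natCast]
  congr 1
  zify at hab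
  push_cast
  linear_combination -(n + 1 : ℤ) * hab

lemma zpow_four_mul_succ_sq_add (q : G) (hab : a + b = 4) (n : ℕ) :
    q ^ (4 * ((n + 1 : ℕ) : ℤ) ^ 2 + (a - b) * ((n + 1 : ℕ) : ℤ))
      = (q ^ 4) ^ (n * (n + 1)) * (q ^ a) ^ (2 * (n + 1)) := by
  rw [← pow_mul, ← pow_mul, ← pow_add, ← zpow_natCast]
  congr 1
  zify at hab
  push_cast
  linear_combination -(n + 1 : ℤ) * hab

end IntegerPowers

section Quartic

variable {x y p q c d : ℂ} {a b : ℕ}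

lemma one_sub_one_div_pow_ne_zero (hq : ‖q‖ < 1) (hq0 : q ≠ 0) (hb : b ≠ 0) :
    1 - 1 / q ^ b ≠ 0 := by
  have hlt := norm_pow_lt_one hq hb
  rw [sub_ne_zero, ne_comm, Ne, div_eq_one_iff_eq (pow_ne_zero b hq0)]
  intro h
  rw [← h, norm_one] at hlt
  exact lt_irrefl 1 hlt

lemma hasSum_alternating_quartic (hq : ‖q‖ < 1) (ha : a ≠ 0) :
    HasSum (fun n : ℕ+ => (-1) ^ (n : ℕ) * q ^ (2 * (n : ℤ) ^ 2 - (2 - a) * (n : ℤ)) /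
        (qPoch (q ^ a) (q ^ 4) n * (1 - q ^ (4 * (n : ℤ)))))
      (-(q ^ a * lambertSeries (q ^ a) (q ^ 4) (q ^ 4))) := by
  have hp := norm_pow_lt_one hq four_ne_zero
  have hx := norm_pow_lt_one hq ha
  refine hasSum_pnat_of_succPNat ?_
  simp only [Nat.succPNat_coe, Nat.succ_eq_add_one, zpow_four_mul_succ, zpow_two_mul_succ_sq_sub]
  refine ((hasSum_altLambertTerm hp hx (qPoch_ne_zero hp hp)).mul_left (q ^ a)).neg.congr_fun
    fun n => ?_
  rw [mul_altLambertTerm_self hp]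
  ring

lemma hasSum_clausen_quartic (hq : ‖q‖ < 1) (ha : a ≠ 0) (hab : a + b = 4) :
    HasSum (fun n : ℕ+ => (1 - q ^ (8 * (n : ℤ) - b)) * q ^ (4 * (n : ℤ) ^ 2 - b * (n : ℤ)) /
        ((1 - q ^ (4 * (n : ℤ) - b)) * (1 - q ^ (4 * (n : ℤ)))))
      (q ^ a * lambertSeries (q ^ a) (q ^ 4) (q ^ 4)) := by
  have hp := norm_pow_lt_one hq four_ne_zero
  have hx := norm_pow_lt_one hq ha
  refine hasSum_pnat_of_succPNat ?_
  simp only [Nat.succPNat_coe, Nat.succ_eq_add_one, zpow_four_mul_succ,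
    zpow_eight_mul_succ_sub q hab, zpow_four_mul_succ_sub q hab, zpow_four_mul_succ_sq_sub q hab]
  refine ((hasSum_clausenTerm hp hx (qPoch_ne_zero hp hp)).mul_left (q ^ a)).congr_fun
    fun n => ?_
  rw [clausenTerm]
  ring

lemma balancedTerm_inv (hp : ‖p‖ < 1) (x c d : ℂ) (n : ℕ) :
    balancedTerm x p c⁻¹ d⁻¹ n = qPoch p p n * qPoch (x / (c * d)) p (n + 1) *
        (-1) ^ (n + 1) * (p ^ ((n + 1).choose 2) * x ^ (n + 1)) /
      (qPoch (x / c) p (n + 1) * qPoch (x / d) p (n + 1) * qPoch p p (n + 1)) := by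
  rw [balancedTerm, qPoch_succ p p n, ← pow_succ', ← div_eq_mul_inv, ← div_eq_mul_inv,
    ← div_eq_mul_inv, div_div, ← mul_div_mul_left _ _ (qPoch_ne_zero hp hp n)]
  congr 1 <;> ring

lemma wellPoisedTerm_inv (hp : ‖p‖ < 1) (hx : ∀ n, qPoch x p n ≠ 0) (hy : y * p = x)
    (hy1 : 1 - y ≠ 0) (hc : c ≠ 0) (hd : d ≠ 0) (r : ℕ) :
    wellPoisedTerm x p c⁻¹ d⁻¹ r = (1 - x * p ^ (2 * r + 1)) * qPoch p p r *
        (qPoch y p (r + 1) * qPoch c p (r + 1) * qPoch d p (r + 1)) *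
        (p ^ (r * (r + 1)) * x ^ (2 * (r + 1))) /
      ((1 - y) * (qPoch (x / c) p (r + 1) * qPoch (x / d) p (r + 1) * qPoch x p (r + 1) *
        qPoch p p (r + 1)) * c ^ (r + 1) * d ^ (r + 1)) := by
  have h : qPoch p p r * qPoch x p r * (1 - y) ≠ 0 :=
    mul_ne_zero (mul_ne_zero (qPoch_ne_zero hp hp r) (hx r)) hy1
  rw [wellPoisedTerm, qPoch_succ p p r, ← pow_succ', qPoch_succ' y, hy, qPoch_succ x p r,
    qFalling_inv hc, qFalling_inv hd, ← div_eq_mul_inv, ← div_eq_mul_inv, div_mul_div_comm,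
    ← mul_div_assoc, div_div, ← mul_div_mul_left _ _ h]
  congr 1 <;> ring

lemma exists_hasSum_bailey_quartic (hq : ‖q‖ < 1) (ha : a ≠ 0) (hb : b ≠ 0) (hab : a + b = 4)
    (hq0 : q ≠ 0) (hc : c ≠ 0) (hd : d ≠ 0) (hac : ∀ n, qPoch (q ^ a / c) (q ^ 4) n ≠ 0)
    (had : ∀ n, qPoch (q ^ a / d) (q ^ 4) n ≠ 0) :
    ∃ S : ℂ,
      HasSum (fun n : ℕ+ =>
        (1 - q ^ (8 * (n : ℤ) - b)) * qPoch (q ^ 4) (q ^ 4) ((n : ℕ) - 1) *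
            (qPoch (1 / q ^ b) (q ^ 4) n * qPoch c (q ^ 4) n * qPoch d (q ^ 4) n) *
            q ^ (4 * (n : ℤ) ^ 2 + (a - b) * (n : ℤ)) /
          ((1 - 1 / q ^ b) *
            (qPoch (q ^ a / c) (q ^ 4) n * qPoch (q ^ a / d) (q ^ 4) n *
              qPoch (q ^ a) (q ^ 4) n * qPoch (q ^ 4) (q ^ 4) n) *
            c ^ (n : ℕ) * d ^ (n : ℕ))) S ∧
      HasSum (fun n : ℕ+ =>
        qPoch (q ^ 4) (q ^ 4) ((n : ℕ) - 1) * qPoch (q ^ a / (c * d)) (q ^ 4) n *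
            (-1) ^ (n : ℕ) * q ^ (2 * (n : ℤ) ^ 2 - (2 - a) * (n : ℤ)) /
          (qPoch (q ^ a / c) (q ^ 4) n * qPoch (q ^ a / d) (q ^ 4) n *
            qPoch (q ^ 4) (q ^ 4) n))
        (S - q ^ a * lambertSeries (q ^ a) (q ^ 4) (q ^ 4)) := by
  have hp := norm_pow_lt_one hq four_ne_zero
  have hx := norm_pow_lt_one hq ha
  have hx0 := qPoch_ne_zero hx hp
  have hy : 1 / q ^ b * q ^ 4 = q ^ a := by
    rw [← hab, pow_add, one_div_mul_eq_div, mul_div_cancel_right₀ _ (pow_ne_zero b hq0)]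
  have hy1 := one_sub_one_div_pow_ne_zero hq hq0 hb
  simp only [div_eq_mul_inv _ c, div_eq_mul_inv _ d] at hac had
  refine ⟨_, hasSum_pnat_of_succPNat ((summable_wellPoisedTerm hp hx0 hac had).hasSum.congr_fun
    fun n => ?_), hasSum_pnat_of_succPNat
      ((hasSum_balancedTerm hp hx hac had).congr_fun fun n => ?_)⟩
  · simp only [Nat.succPNat_coe, Nat.succ_eq_add_one, add_tsub_cancel_right,
      zpow_eight_mul_succ_sub q hab, zpow_four_mul_succ_sq_add q hab,
      wellPoisedTerm_inv hp hx0 hy hy1 hc hd]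
  · simp only [Nat.succPNat_coe, Nat.succ_eq_add_one, add_tsub_cancel_right,
      zpow_two_mul_succ_sq_sub, balancedTerm_inv hp]

end Quartic

theorem mainTheorem9 (q : ℂ) (hq : ‖q‖ < 1) :
    -- the theta series converges
    Summable (fun n : ℤ => q ^ (n ^ 2)) ∧
    -- first expansion
    (∃ A B : ℂ,
      HasSum (fun n : ℕ+ =>
        (-1) ^ (n : ℕ) * q ^ (2 * (n : ℤ) ^ 2 - (n : ℤ)) /
          (qPoch q (q ^ 4) n * (1 - q ^ (4 * (n : ℤ))))) A ∧
      HasSum (fun n : ℕ+ =>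
        (-1) ^ (n : ℕ) * q ^ (2 * (n : ℤ) ^ 2 + (n : ℤ)) /
          (qPoch (q ^ 3) (q ^ 4) n * (1 - q ^ (4 * (n : ℤ))))) B ∧
      ramanujanPhi q ^ 2 = 1 - 4 * A + 4 * B) ∧
    -- second expansion
    (∃ A B : ℂ,
      HasSum (fun n : ℕ+ =>
        (1 - q ^ (8 * (n : ℤ) - 3)) * q ^ (4 * (n : ℤ) ^ 2 - 3 * (n : ℤ)) /
          ((1 - q ^ (4 * (n : ℤ) - 3)) * (1 - q ^ (4 * (n : ℤ))))) A ∧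
      HasSum (fun n : ℕ+ =>
        (1 - q ^ (8 * (n : ℤ) - 1)) * q ^ (4 * (n : ℤ) ^ 2 - (n : ℤ)) /
          ((1 - q ^ (4 * (n : ℤ) - 1)) * (1 - q ^ (4 * (n : ℤ))))) B ∧
      ramanujanPhi q ^ 2 = 1 + 4 * A - 4 * B) ∧
    -- the identity with two free parameters that make no denominator vanish
    (∀ c d : ℂ, q ≠ 0 → c ≠ 0 → d ≠ 0 →
      (∀ n : ℕ, qPoch (q ^ 3 / c) (q ^ 4) n ≠ 0) →
      (∀ n : ℕ, qPoch (q ^ 3 / d) (q ^ 4) n ≠ 0) →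
      (∀ n : ℕ, qPoch (q / c) (q ^ 4) n ≠ 0) →
      (∀ n : ℕ, qPoch (q / d) (q ^ 4) n ≠ 0) →
      ∃ S₁ S₂ S₃ S₄ : ℂ,
        HasSum (fun n : ℕ+ =>
          qPoch (q ^ 4) (q ^ 4) ((n : ℕ) - 1) * qPoch (q ^ 3 / (c * d)) (q ^ 4) n *
              (-1) ^ (n : ℕ) * q ^ (2 * (n : ℤ) ^ 2 + (n : ℤ)) /
            (qPoch (q ^ 3 / c) (q ^ 4) n * qPoch (q ^ 3 / d) (q ^ 4) n *
              qPoch (q ^ 4) (q ^ 4) n)) S₁ ∧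
        HasSum (fun n : ℕ+ =>
          qPoch (q ^ 4) (q ^ 4) ((n : ℕ) - 1) * qPoch (q / (c * d)) (q ^ 4) n *
              (-1) ^ (n : ℕ) * q ^ (2 * (n : ℤ) ^ 2 - (n : ℤ)) /
            (qPoch (q / c) (q ^ 4) n * qPoch (q / d) (q ^ 4) n *
              qPoch (q ^ 4) (q ^ 4) n)) S₂ ∧
        HasSum (fun n : ℕ+ =>
          (1 - q ^ (8 * (n : ℤ) - 1)) * qPoch (q ^ 4) (q ^ 4) ((n : ℕ) - 1) *
              (qPoch (1 / q) (q ^ 4) n * qPoch c (q ^ 4) n * qPoch d (q ^ 4) n) *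
              q ^ (4 * (n : ℤ) ^ 2 + 2 * (n : ℤ)) /
            ((1 - 1 / q) *
              (qPoch (q ^ 3 / c) (q ^ 4) n * qPoch (q ^ 3 / d) (q ^ 4) n *
                qPoch (q ^ 3) (q ^ 4) n * qPoch (q ^ 4) (q ^ 4) n) *
              c ^ (n : ℕ) * d ^ (n : ℕ))) S₃ ∧
        HasSum (fun n : ℕ+ =>
          (1 - q ^ (8 * (n : ℤ) - 3)) * qPoch (q ^ 4) (q ^ 4) ((n : ℕ) - 1) *
              (qPoch (1 / q ^ 3) (q ^ 4) n * qPoch c (q ^ 4) n * qPoch d (q ^ 4) n) *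
              q ^ (4 * (n : ℤ) ^ 2 - 2 * (n : ℤ)) /
            ((1 - 1 / q ^ 3) *
              (qPoch (q / c) (q ^ 4) n * qPoch (q / d) (q ^ 4) n *
                qPoch q (q ^ 4) n * qPoch (q ^ 4) (q ^ 4) n) *
              c ^ (n : ℕ) * d ^ (n : ℕ))) S₄ ∧
        ramanujanPhi q ^ 2 = 1 + 4 * S₁ - 4 * S₂ - 4 * S₃ + 4 * S₄) := by
  have hphi := ramanujanPhi_sq hq
  refine ⟨(hasSum_pow_sq hq).summable, ?first, ?second, ?parameters⟩
  case first =>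
    refine ⟨-(q * lambertSeries q (q ^ 4) (q ^ 4)),
      -(q ^ 3 * lambertSeries (q ^ 3) (q ^ 4) (q ^ 4)), ?_, ?_, by rw [hphi]; ring⟩
    · simpa using hasSum_alternating_quartic hq one_ne_zero
    · have h := hasSum_alternating_quartic hq three_ne_zero
      norm_num at h
      exact h
  case second =>
    refine ⟨q * lambertSeries q (q ^ 4) (q ^ 4),
      q ^ 3 * lambertSeries (q ^ 3) (q ^ 4) (q ^ 4), ?_, ?_, by rw [hphi]; ring⟩
    · simpa using hasSum_clausen_quartic hq one_ne_zero (b := 3) rfl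
    · simpa using hasSum_clausen_quartic hq three_ne_zero (b := 1) rfl
  case parameters =>
    intro c d hq0 hc hd h3c h3d h1c h1d
    obtain ⟨S₃, h₃, h₁⟩ :=
      exists_hasSum_bailey_quartic hq three_ne_zero one_ne_zero rfl hq0 hc hd h3c h3d
    obtain ⟨S₄, h₄, h₂⟩ := exists_hasSum_bailey_quartic (a := 1) hq one_ne_zero three_ne_zero rfl
      hq0 hc hd (by simpa using h1c) (by simpa using h1d)
    norm_num at h₁ h₂ h₃ h₄
    refine ⟨_, _, S₃, S₄, by simpa using h₁, by simpa using h₂, by simpa using h₃,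
      by simpa [sub_eq_add_neg] using h₄, ?_⟩
    rw [hphi]
    ring
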